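/- Let $a \ge 2$ be a fixed integer. For a 2-coloring $\chi$ of $[1,n]=\{1,\dots,n\}$, let $M_{\chi,a}(n)$ be the number of triples $(x,y,x+ay)$ of elements of $[1,n]$ (with $x=y$ allowed) whose three entries all have the same color. There is a constant $C$, depending only on $a$, such that for every $n$ every 2-coloring $\chi$ of $[1,n]$ satisfies $$M_{\chi,a}(n) \;\ge\; \frac{n^2}{2a(a^2+2a+3)} - Cn .$$ This is optimal up to the linear term: for every $n$ there is a 2-coloring $\chi$ of $[1,n]$ with $M_{\chi,a}(n) \le \frac{n^2}{2a(a^2+2a+3)} + Cn$. Hence the minimum of $M_{\chi,a}(n)$ over all 2-colorings of $[1,n]$ is $\frac{n^2}{2a(a^2+2a+3)}+O(n)$, which answers Graham's question on this minimum. Moreover, the total number $T_a(n)$ of triples $(x,y,x+ay)$ in $[1,n]$, monochromatic or not, satisfies $\left|T_a(n)-\frac{n^2}{2a}\right|\le Cn$. -/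

import Mathlib

/-- The triples `(x, y, z)` of elements of `[1, n]` with `z = x + a * y`. -/
def schurTriples (a n : ℕ) : Finset (ℕ × ℕ × ℕ) :=
  (Finset.Icc 1 n ×ˢ Finset.Icc 1 n ×ˢ Finset.Icc 1 n).filter
    fun t => t.1 + a * t.2.1 = t.2.2

/-- The number of triples `(x, y, x + a * y)` in `[1, n]` that are monochromatic for the
2-coloring `χ`. Only the values of `χ` on `[1, n]` matter. -/
def monoCount (a n : ℕ) (χ : ℕ → Bool) : ℕ :=
  ((schurTriples a n).filter fun t => χ t.1 = χ t.2.1 ∧ χ t.2.1 = χ t.2.2).card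

/-! Give the colors signs ±1. Four times the indicator of a monochromatic triple is 1 plus its three
pairwise sign products (`four_mul_monoCount`), so 4M is the number of triples plus three
correlations. First and last entries are the pairs congruent mod a, and Cauchy-Schwarz over residue
classes bounds their correlation below. If 2a divides n, the two correlations with y combine into a
product of sign sums minus ∑ sign(y) K(y), where K(y), the sign sum of [1, ay] minus that of [1, n -
ay], is odd about y = n/(2a). Trivially |K(y)| ≤ n - 2ay for y up to the centre. Two gains make this
sharp: shifting K by a constant (`sum_mul_le_of_antisymm`), and a loss forced by both colors
occurring in (ay, n - ay] (`abs_imbalance_le`).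

Let at most half of [1, n] be red, with α red elements in [1, n/a] and γ beyond. In the decisive
case 4aM ≥ 2(q² + γ² + α²) - O(n) with q = n - γ - (a+1)α. As n = q + γ + (a+1)α, Cauchy-Schwarz
gives 2n²/D, where D = 1 + 1 + (a+1)² = a² + 2a + 3. Weaker estimates suffice in the other cases.
Equality, q = γ = n/D and α = (a+1)n/D, suggests the extremal coloring: red on an initial block of
length (a+1)n/D and a final one of length n/D, blue between. -/

/-! ### Ramp sums and the number of triples -/

/-- A ramp sum is at most the area under the ramp plus its height. -/
theorem sum_range_ramp_le (k : ℝ) (hk : 0 < k) (N : ℕ) :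
    ∀ c : ℝ, 0 ≤ c → ∑ y ∈ Finset.range N, max (c - k * (y : ℝ)) 0 ≤ c ^ 2 / (2 * k) + c := by
  induction N with
  | zero => intro c hc; simp; positivity
  | succ N ih =>
    intro c hc
    rw [Finset.sum_range_succ']
    have e : ∀ y : ℕ, c - k * ((y + 1 : ℕ) : ℝ) = (c - k) - k * (y : ℝ) := by
      intro y; push_cast; ring
    simp only [e]
    rw [show c - k * ((0 : ℕ) : ℝ) = c by simp, max_eq_left hc]
    rcases le_total k c with h | h
    · have h1 := ih (c - k) (by linarith)
      have h2 : (c - k) ^ 2 / (2 * k) = c ^ 2 / (2 * k) - c + k / 2 := by field_simp; ring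
      linarith
    · have h1 : ∑ y ∈ Finset.range N, max ((c - k) - k * (y : ℝ)) 0 = 0 := by
        refine Finset.sum_eq_zero fun y _ => max_eq_right ?_
        have : 0 ≤ k * (y : ℝ) := by positivity
        linarith
      have h2 : 0 ≤ c ^ 2 / (2 * k) := by positivity
      linarith

/-- A ramp sum that reaches the foot of the ramp is at least the area under it. -/
theorem le_sum_range_ramp (k : ℝ) (hk : 0 < k) (N : ℕ) :
    ∀ c : ℝ, 0 ≤ c → c ≤ k * N → c ^ 2 / (2 * k) ≤ ∑ y ∈ Finset.range N, max (c - k * (y : ℝ)) 0 := by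
  induction N with
  | zero => intro c hc hN; have : c = 0 := by simp at hN; linarith
            simp [this]
  | succ N ih =>
    intro c hc hN
    rw [Finset.sum_range_succ']
    have e : ∀ y : ℕ, c - k * ((y + 1 : ℕ) : ℝ) = (c - k) - k * (y : ℝ) := by
      intro y; push_cast; ring
    simp only [e]
    rw [show c - k * ((0 : ℕ) : ℝ) = c by simp, max_eq_left hc]
    push_cast at hN
    rcases le_total k c with h | h
    · have h1 := ih (c - k) (by linarith) (by linarith)
      have h2 : (c - k) ^ 2 / (2 * k) = c ^ 2 / (2 * k) - c + k / 2 := by field_simp; ring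
      linarith
    · have h1 : 0 ≤ ∑ y ∈ Finset.range N, max ((c - k) - k * (y : ℝ)) 0 :=
        Finset.sum_nonneg fun y _ => le_max_right _ _
      have h2 : c ^ 2 / (2 * k) ≤ c := by
        rw [div_le_iff₀ (by positivity)]; nlinarith
      linarith

/-- A sum over the triples, organised by the second entry and the last one. -/
theorem sum_schurTriples_eq_sum_last {a n : ℕ} (f : ℕ × ℕ × ℕ → ℝ) :
    ∑ t ∈ schurTriples a n, f t =
      ∑ y ∈ Finset.Ioc 0 n, ∑ z ∈ Finset.Ioc (a * y) n, f (z - a * y, y, z) := by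
  rw [Finset.sum_sigma']
  refine Finset.sum_nbij' (fun t => ⟨t.2.1, t.2.2⟩) (fun p => (p.2 - a * p.1, p.1, p.2))
    ?_ ?_ ?_ ?_ ?_
  · rintro ⟨x, y, z⟩ h
    simp only [schurTriples, Finset.mem_filter, Finset.mem_product, Finset.mem_Icc] at h
    simp only [Finset.mem_sigma, Finset.mem_Ioc]
    omega
  · rintro ⟨y, z⟩ h
    simp only [Finset.mem_sigma, Finset.mem_Ioc] at h
    simp only [schurTriples, Finset.mem_filter, Finset.mem_product, Finset.mem_Icc]
    omega
  · rintro ⟨x, y, z⟩ h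
    simp only [schurTriples, Finset.mem_filter, Finset.mem_product, Finset.mem_Icc] at h
    simp only [Prod.mk.injEq, and_true]
    omega
  · rintro ⟨y, z⟩ h
    rfl
  · rintro ⟨x, y, z⟩ h
    simp only [schurTriples, Finset.mem_filter, Finset.mem_product, Finset.mem_Icc] at h
    have : x = z - a * y := by omega
    rw [this]

/-- A sum over the triples, organised by the second entry and the first one. -/
theorem sum_schurTriples_eq_sum_first {a n : ℕ} (f : ℕ × ℕ × ℕ → ℝ) :
    ∑ t ∈ schurTriples a n, f t =
      ∑ y ∈ Finset.Ioc 0 n, ∑ x ∈ Finset.Ioc 0 (n - a * y), f (x, y, x + a * y) := by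
  rw [Finset.sum_sigma']
  refine Finset.sum_nbij' (fun t => ⟨t.2.1, t.1⟩) (fun p => (p.2, p.1, p.2 + a * p.1))
    ?_ ?_ ?_ ?_ ?_
  · rintro ⟨x, y, z⟩ h
    simp only [schurTriples, Finset.mem_filter, Finset.mem_product, Finset.mem_Icc] at h
    simp only [Finset.mem_sigma, Finset.mem_Ioc]
    omega
  · rintro ⟨y, x⟩ h
    simp only [Finset.mem_sigma, Finset.mem_Ioc] at h
    simp only [schurTriples, Finset.mem_filter, Finset.mem_product, Finset.mem_Icc]
    refine ⟨?_, trivial⟩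
    omega
  · rintro ⟨x, y, z⟩ h
    simp only [schurTriples, Finset.mem_filter, Finset.mem_product, Finset.mem_Icc] at h
    simp only [Prod.mk.injEq, true_and]
    omega
  · rintro ⟨y, z⟩ h
    rfl
  · rintro ⟨x, y, z⟩ h
    simp only [schurTriples, Finset.mem_filter, Finset.mem_product, Finset.mem_Icc] at h
    have : z = x + a * y := by omega
    rw [this]

theorem card_schurTriples_eq (a n : ℕ) :
    ((schurTriples a n).card : ℝ) =
      ∑ y ∈ Finset.range (n + 1), max ((n : ℝ) - a * (y : ℝ)) 0 - n := by
  have h := sum_schurTriples_eq_sum_first (a := a) (n := n) (fun _ => (1 : ℝ))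
  simp only [Finset.sum_const, nsmul_eq_mul, mul_one, Nat.card_Ioc, Nat.sub_zero] at h
  rw [h, Finset.sum_range_succ']
  have hn : max ((n : ℝ) - a * ((0 : ℕ) : ℝ)) 0 = n := by simp
  rw [hn, add_sub_cancel_right, Finset.range_eq_Ico,
    Finset.sum_Ico_add' (fun y : ℕ => max ((n : ℝ) - a * (y : ℝ)) 0) 0 n 1]
  refine Finset.sum_congr (by ext; simp; omega) fun y _ => ?_
  rcases le_total (a * y) n with hy | hy
  · have : (a : ℝ) * y ≤ n := by exact_mod_cast hy
    rw [Nat.cast_sub hy, max_eq_left (by linarith)]; push_cast; ring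
  · have : (n : ℝ) ≤ a * y := by exact_mod_cast hy
    rw [Nat.sub_eq_zero_of_le hy, max_eq_right (by linarith)]; simp

theorem card_schurTriples_le {a : ℕ} (n : ℕ) (ha : 1 ≤ a) :
    ((schurTriples a n).card : ℝ) ≤ (n : ℝ) ^ 2 / (2 * a) := by
  rw [card_schurTriples_eq]
  have := sum_range_ramp_le (a : ℝ) (by exact_mod_cast ha) (n + 1) n (by positivity)
  linarith

theorem le_card_schurTriples {a : ℕ} (n : ℕ) (ha : 1 ≤ a) :
    (n : ℝ) ^ 2 / (2 * a) - n ≤ ((schurTriples a n).card : ℝ) := by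
  rw [card_schurTriples_eq]
  have ha' : (1 : ℝ) ≤ a := by exact_mod_cast ha
  have := le_sum_range_ramp (a : ℝ) (by linarith) (n + 1) n (by positivity)
    (by push_cast; nlinarith [(Nat.cast_nonneg n : (0 : ℝ) ≤ n)])
  linarith

/-! ### A coloring with few monochromatic triples -/

/-- With k = ⌊n/D⌋ and A = (a+1)k, the monochromatic triples form three families: all entries in the
initial block; x and z in the final block with y small; all entries blue. Translation makes them
triples in [1, A], [1, k] and [1, k + r], and A² + 2k² = Dk². -/
theorem exists_monoCount_le (a : ℕ) (ha : 2 ≤ a) (n : ℕ) :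
    ∃ χ : ℕ → Bool, (monoCount a n χ : ℝ) ≤
      (n : ℝ) ^ 2 / (2 * (a : ℝ) * ((a : ℝ) ^ 2 + 2 * (a : ℝ) + 3))
        + ((a : ℝ) ^ 2 + 2 * (a : ℝ) + 3) * n := by
  set D := a ^ 2 + 2 * a + 3 with hD
  set k := n / D with hk
  set r := n % D with hr
  have hn : D * k + r = n := Nat.div_add_mod n D
  have hrD : r < D := Nat.mod_lt _ (by positivity)
  have hDk : D * k = (a + 1) * ((a + 1) * k) + k + k := by rw [hD]; ring
  set A := (a + 1) * k with hA
  refine ⟨fun x => decide (x ≤ A ∨ n - k < x), ?_⟩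
  have hsub : (schurTriples a n).filter (fun t =>
      decide (t.1 ≤ A ∨ n - k < t.1) = decide (t.2.1 ≤ A ∨ n - k < t.2.1) ∧
      decide (t.2.1 ≤ A ∨ n - k < t.2.1) = decide (t.2.2 ≤ A ∨ n - k < t.2.2)) ⊆
      (schurTriples a A ∪ (schurTriples a k).image
        (fun t => (t.1 + (n - k), t.2.1, t.2.2 + (n - k)))) ∪
      (schurTriples a (k + r)).image
        (fun t => (t.1 + A, t.2.1 + A, t.2.2 + (a + 1) * A)) := by
    rintro ⟨x, y, z⟩ h
    simp only [schurTriples, Finset.mem_filter, Finset.mem_product, Finset.mem_Icc,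
      decide_eq_decide] at h
    obtain ⟨⟨⟨hx, hy, hz⟩, hxyz⟩, h1, h2⟩ := h
    have e1 : (a + 1) * A = a * A + A := by ring
    simp only [Finset.mem_union, Finset.mem_image]
    have hyay : 2 * y ≤ a * y := Nat.mul_le_mul_right _ ha
    -- A red y lies in the initial block, since otherwise z ≥ 2y would exceed n.
    by_cases hyr : y ≤ A ∨ n - k < y
    · have hyA : y ≤ A := by
        rcases hyr with h | h
        · exact h
        · omega
      have hay : a * y ≤ a * A := Nat.mul_le_mul_left _ hyA
      left
      rcases h1.2 hyr with hx' | hx'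
      · left
        have hzA : z ≤ A := by
          rcases h2.1 hyr with h | h
          · exact h
          · omega
        simp only [schurTriples, Finset.mem_filter, Finset.mem_product, Finset.mem_Icc]
        omega
      · right
        refine ⟨(x - (n - k), y, z - (n - k)), ?_, ?_⟩
        · simp only [schurTriples, Finset.mem_filter, Finset.mem_product, Finset.mem_Icc]
          omega
        · simp only [Prod.mk.injEq, true_and]
          omega
    · right
      have hxr : ¬(x ≤ A ∨ n - k < x) := fun h => hyr (h1.1 h)
      have hzr : ¬(z ≤ A ∨ n - k < z) := fun h => hyr (h2.2 h)
      push Not at hyr hxr hzr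
      obtain ⟨y', rfl⟩ : ∃ y', y = y' + A := ⟨y - A, by omega⟩
      have hay : a * (y' + A) = a * y' + a * A := by ring
      have hy' : 2 * y' ≤ a * y' := Nat.mul_le_mul_right _ ha
      refine ⟨(x - A, y', z - (a + 1) * A), ?_, ?_⟩
      · simp only [schurTriples, Finset.mem_filter, Finset.mem_product, Finset.mem_Icc]
        omega
      · simp only [Prod.mk.injEq, true_and]
        omega
  have hcard : monoCount a n (fun x => decide (x ≤ A ∨ n - k < x)) ≤
      (schurTriples a A).card + (schurTriples a k).card + (schurTriples a (k + r)).card := by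
    refine (Finset.card_le_card hsub).trans ((Finset.card_union_le _ _).trans ?_)
    exact add_le_add ((Finset.card_union_le _ _).trans
      (add_le_add le_rfl Finset.card_image_le)) Finset.card_image_le
  have hcard' : (monoCount a n (fun x => decide (x ≤ A ∨ n - k < x)) : ℝ) ≤
      (schurTriples a A).card + (schurTriples a k).card + (schurTriples a (k + r)).card := by
    exact_mod_cast hcard
  have c1 := card_schurTriples_le A (show 1 ≤ a by omega)
  have c2 := card_schurTriples_le k (show 1 ≤ a by omega)
  have c3 := card_schurTriples_le (k + r) (show 1 ≤ a by omega)
  have ha' : (2 : ℝ) ≤ a := by exact_mod_cast ha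
  have hDR : (a : ℝ) ^ 2 + 2 * a + 3 = (D : ℝ) := by rw [hD]; push_cast; ring
  have hDpos : (0 : ℝ) < D := by rw [← hDR]; positivity
  have hnR : (n : ℝ) = D * k + r := by exact_mod_cast hn.symm
  have hAR : (A : ℝ) = (a + 1) * k := by rw [hA]; push_cast; ring
  have hrn : (r : ℝ) ≤ n := by exact_mod_cast Nat.mod_le n D
  have hrDR : (r : ℝ) ≤ D := by exact_mod_cast hrD.le
  rw [hDR]
  have key : ((A : ℝ) ^ 2 + k ^ 2 + (k + r) ^ 2) / (2 * a) ≤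
      (n : ℝ) ^ 2 / (2 * a * D) + D * n := by
    have h1 : (A : ℝ) ^ 2 + k ^ 2 + (k + r) ^ 2 ≤ (n : ℝ) ^ 2 / D + D * n := by
      have : (n : ℝ) ^ 2 / D = D * k ^ 2 + 2 * k * r + r ^ 2 / D := by
        rw [hnR]; field_simp
        try ring
      rw [this, hAR, show ((a + 1 : ℝ) * k) ^ 2 = (D - 2) * k ^ 2 by rw [← hDR]; ring]
      have h2 : 0 ≤ (r : ℝ) ^ 2 / D := by positivity
      nlinarith [mul_le_mul hrDR hrn (by positivity) hDpos.le]
    calc _ ≤ ((n : ℝ) ^ 2 / D + D * n) / (2 * a) := by gcongr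
      _ = (n : ℝ) ^ 2 / (2 * a * D) + D * n / (2 * a) := by field_simp
      _ ≤ _ := by
        gcongr
        exact div_le_self (by positivity) (by linarith)
  push_cast at c3
  calc _ ≤ _ := hcard'
    _ ≤ (A : ℝ) ^ 2 / (2 * a) + (k : ℝ) ^ 2 / (2 * a) + ((k : ℝ) + r) ^ 2 / (2 * a) := by
      linarith
    _ = ((A : ℝ) ^ 2 + k ^ 2 + (k + r) ^ 2) / (2 * a) := by ring
    _ ≤ _ := key

/-! ### Monochromatic triples and correlations of the sign of a coloring -/

/-- The sign of a coloring: `1` on `true` ("red") and `-1` on `false` ("blue"). -/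
def colorSign (χ : ℕ → Bool) (x : ℕ) : ℝ := if χ x then 1 else -1

/-- The number of red elements of `[1, t]`. -/
def redCount (χ : ℕ → Bool) (t : ℕ) : ℕ := ((Finset.Ioc 0 t).filter fun x => χ x = true).card

theorem colorSign_mul_self (χ : ℕ → Bool) (x : ℕ) : colorSign χ x * colorSign χ x = 1 := by
  unfold colorSign; split_ifs <;> norm_num

theorem abs_colorSign (χ : ℕ → Bool) (x : ℕ) : |colorSign χ x| = 1 := by
  unfold colorSign; split_ifs <;> simp

theorem redCount_zero (χ : ℕ → Bool) : redCount χ 0 = 0 := by simp [redCount]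

theorem redCount_mono (χ : ℕ → Bool) {s t : ℕ} (h : s ≤ t) : redCount χ s ≤ redCount χ t :=
  Finset.card_le_card (Finset.filter_subset_filter _ (Finset.Ioc_subset_Ioc_right h))

theorem redCount_le_add (χ : ℕ → Bool) {s t : ℕ} (h : s ≤ t) :
    redCount χ t ≤ redCount χ s + (t - s) := by
  unfold redCount
  rw [← Finset.Ioc_union_Ioc_eq_Ioc (Nat.zero_le s) h, Finset.filter_union]
  refine (Finset.card_union_le _ _).trans (add_le_add le_rfl ?_)
  exact (Finset.card_filter_le _ _).trans (by simp)

theorem sum_colorSign (χ : ℕ → Bool) (t : ℕ) :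
    ∑ x ∈ Finset.Ioc 0 t, colorSign χ x = 2 * (redCount χ t : ℝ) - t := by
  have h : ∀ x, colorSign χ x = 2 * (if χ x = true then (1 : ℝ) else 0) - 1 := by
    intro x; unfold colorSign; split_ifs <;> norm_num
  simp only [h, Finset.sum_sub_distrib, ← Finset.mul_sum, Finset.sum_boole, redCount]
  simp

theorem four_mul_monoCount (a n : ℕ) (χ : ℕ → Bool) :
    4 * (monoCount a n χ : ℝ) = (schurTriples a n).card
      + ∑ t ∈ schurTriples a n, colorSign χ t.1 * colorSign χ t.2.1
      + ∑ t ∈ schurTriples a n, colorSign χ t.2.1 * colorSign χ t.2.2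
      + ∑ t ∈ schurTriples a n, colorSign χ t.1 * colorSign χ t.2.2 := by
  have key : ∀ p q r : Bool, 4 * (if p = q ∧ q = r then (1 : ℝ) else 0) =
      1 + (if p then 1 else -1) * (if q then 1 else -1)
        + (if q then 1 else -1) * (if r then 1 else -1)
        + (if p then 1 else -1) * (if r then 1 else -1) := by
    rintro (_ | _) (_ | _) (_ | _) <;> norm_num
  rw [monoCount, ← Finset.sum_boole, Finset.mul_sum, Finset.card_eq_sum_ones, Nat.cast_sum,
    ← Finset.sum_add_distrib, ← Finset.sum_add_distrib, ← Finset.sum_add_distrib]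
  refine Finset.sum_congr rfl fun t _ => ?_
  rw [Nat.cast_one]
  exact key (χ t.1) (χ t.2.1) (χ t.2.2)

theorem monoCount_not (a n : ℕ) (χ : ℕ → Bool) :
    monoCount a n (fun x => !χ x) = monoCount a n χ := by
  unfold monoCount
  congr 1
  refine Finset.filter_congr fun t _ => ?_
  simp only [Bool.not_inj_iff]

theorem redCount_not (χ : ℕ → Bool) (n : ℕ) :
    redCount (fun x => !χ x) n + redCount χ n = n := by
  unfold redCount
  have := Finset.card_filter_add_card_filter_not (s := Finset.Ioc 0 n) (fun x => χ x = true)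
  simp only [Nat.card_Ioc, Nat.sub_zero, Bool.not_eq_true] at this
  simpa [add_comm] using this

theorem monoCount_mono (a : ℕ) (χ : ℕ → Bool) {m n : ℕ} (h : m ≤ n) :
    monoCount a m χ ≤ monoCount a n χ := by
  refine Finset.card_le_card (Finset.filter_subset_filter _ ?_)
  rintro ⟨x, y, z⟩ ht
  simp only [schurTriples, Finset.mem_filter, Finset.mem_product, Finset.mem_Icc] at ht ⊢
  omega

/-- The correlations within residue classes modulo `a` are bounded below by Cauchy-Schwarz. -/
theorem sq_sum_le_mul_sum_modEq (a n : ℕ) (ha : 1 ≤ a) (s : ℕ → ℝ) :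
    (∑ x ∈ Finset.Ioc 0 n, s x) ^ 2 ≤ a * ∑ p ∈ Finset.Ioc 0 n ×ˢ Finset.Ioc 0 n,
      if p.1 % a = p.2 % a then s p.1 * s p.2 else 0 := by
  have h1 : ∑ x ∈ Finset.Ioc 0 n, s x =
      ∑ j ∈ Finset.range a, ∑ x ∈ Finset.Ioc 0 n, if x % a = j then s x else 0 := by
    rw [Finset.sum_comm]
    refine Finset.sum_congr rfl fun x _ => ?_
    rw [Finset.sum_ite_eq, if_pos (Finset.mem_range.2 (Nat.mod_lt _ ha))]
  have h2 : ∑ j ∈ Finset.range a, (∑ x ∈ Finset.Ioc 0 n, if x % a = j then s x else 0) ^ 2 =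
      ∑ p ∈ Finset.Ioc 0 n ×ˢ Finset.Ioc 0 n,
        if p.1 % a = p.2 % a then s p.1 * s p.2 else 0 := by
    simp only [sq, Finset.sum_mul_sum]
    rw [Finset.sum_product, Finset.sum_comm]
    refine Finset.sum_congr rfl fun x _ => ?_
    rw [Finset.sum_comm]
    refine Finset.sum_congr rfl fun z _ => ?_
    simp only [ite_mul, zero_mul]
    rw [Finset.sum_ite_eq, if_pos (Finset.mem_range.2 (Nat.mod_lt _ ha))]
    simp only [mul_ite, mul_zero, eq_comm]
  rw [← h2, h1]
  refine sq_sum_le_card_mul_sum_sq.trans (by simp)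

/-- Ordered congruent pairs split into x < z, x > z and the diagonal; a pair x < z determines the
triple with y = (z - x)/a. -/
theorem sum_modEq_eq (a n : ℕ) (ha : 1 ≤ a) (s : ℕ → ℝ) :
    (∑ p ∈ Finset.Ioc 0 n ×ˢ Finset.Ioc 0 n, if p.1 % a = p.2 % a then s p.1 * s p.2 else 0) =
      2 * ∑ t ∈ schurTriples a n, s t.1 * s t.2.2 + ∑ x ∈ Finset.Ioc 0 n, s x * s x := by
  have hlt : ∑ p ∈ Finset.Ioc 0 n ×ˢ Finset.Ioc 0 n,
      (if p.1 % a = p.2 % a ∧ p.1 < p.2 then s p.1 * s p.2 else 0) =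
      ∑ t ∈ schurTriples a n, s t.1 * s t.2.2 := by
    rw [← Finset.sum_filter]
    refine Finset.sum_nbij' (fun p => (p.1, (p.2 - p.1) / a, p.2)) (fun t => (t.1, t.2.2))
      ?_ ?_ ?_ ?_ ?_
    · rintro ⟨x, z⟩ h
      simp only [Finset.mem_filter, Finset.mem_product, Finset.mem_Ioc] at h
      simp only [schurTriples, Finset.mem_filter, Finset.mem_product, Finset.mem_Icc]
      obtain ⟨c, hc⟩ := (Nat.modEq_iff_dvd' h.2.2.le).1 h.2.1
      rw [hc, Nat.mul_div_cancel_left _ ha]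
      have h1 : c ≤ a * c := Nat.le_mul_of_pos_left _ ha
      have h2 : 0 < c := by
        rcases Nat.eq_zero_or_pos c with h | h
        · subst h; omega
        · exact h
      omega
    · rintro ⟨x, y, z⟩ h
      simp only [schurTriples, Finset.mem_filter, Finset.mem_product, Finset.mem_Icc] at h
      simp only [Finset.mem_filter, Finset.mem_product, Finset.mem_Ioc]
      have h1 : y ≤ a * y := Nat.le_mul_of_pos_left _ ha
      refine ⟨by omega, ?_, by omega⟩
      rw [← h.2, Nat.add_mul_mod_self_left]
    · rintro ⟨x, z⟩ _
      rfl
    · rintro ⟨x, y, z⟩ h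
      simp only [schurTriples, Finset.mem_filter, Finset.mem_product, Finset.mem_Icc] at h
      simp only [Prod.mk.injEq, and_true, true_and]
      rw [← h.2, Nat.add_sub_cancel_left, Nat.mul_div_cancel_left _ ha]
    · rintro ⟨x, z⟩ _
      rfl
  have hgt : ∑ p ∈ Finset.Ioc 0 n ×ˢ Finset.Ioc 0 n,
      (if p.1 % a = p.2 % a ∧ p.2 < p.1 then s p.1 * s p.2 else 0) =
      ∑ t ∈ schurTriples a n, s t.1 * s t.2.2 := by
    rw [← hlt, Finset.sum_product, Finset.sum_product_right]
    refine Finset.sum_congr rfl fun x _ => Finset.sum_congr rfl fun z _ => ?_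
    simp only [eq_comm (a := x % a), mul_comm (s x)]
  have heq : ∑ p ∈ Finset.Ioc 0 n ×ˢ Finset.Ioc 0 n,
      (if p.1 = p.2 then s p.1 * s p.2 else 0) = ∑ x ∈ Finset.Ioc 0 n, s x * s x := by
    rw [Finset.sum_product]
    refine Finset.sum_congr rfl fun x hx => ?_
    simp only [Finset.sum_ite_eq, if_pos hx]
  rw [two_mul]
  nth_rw 1 [← hlt]
  rw [← hgt, ← heq, ← Finset.sum_add_distrib, ← Finset.sum_add_distrib]
  refine Finset.sum_congr rfl fun p _ => ?_
  by_cases hm : p.1 % a = p.2 % a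
  · rcases lt_trichotomy p.1 p.2 with h | h | h
    · simp [hm, h, h.ne, h.not_gt]
    · simp [h]
    · simp [hm, h, h.ne', h.not_gt]
  · have : p.1 ≠ p.2 := fun h => hm (by rw [h])
    simp [hm, this]

theorem le_sum_colorSign_first_last (a n : ℕ) (ha : 1 ≤ a) (χ : ℕ → Bool) :
    (2 * (redCount χ n : ℝ) - n) ^ 2 / (2 * a) - n / 2 ≤
      ∑ t ∈ schurTriples a n, colorSign χ t.1 * colorSign χ t.2.2 := by
  have h1 := sq_sum_le_mul_sum_modEq a n ha (colorSign χ)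
  rw [sum_modEq_eq a n ha, sum_colorSign] at h1
  simp only [colorSign_mul_self, Finset.sum_const, Nat.card_Ioc, Nat.sub_zero, nsmul_eq_mul,
    mul_one] at h1
  have ha' : (0 : ℝ) < a := by exact_mod_cast ha
  have h2 : (2 * (redCount χ n : ℝ) - n) ^ 2 / a ≤
      2 * ∑ t ∈ schurTriples a n, colorSign χ t.1 * colorSign χ t.2.2 + n := by
    rw [div_le_iff₀ ha']; linarith
  have h3 : (2 * (redCount χ n : ℝ) - n) ^ 2 / (2 * a) =
      (2 * (redCount χ n : ℝ) - n) ^ 2 / a / 2 := by field_simp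
  linarith

/-- For fixed y, x runs over [1, aM - ay] and z over (ay, aM]; no triple has y ≥ M. -/
theorem sum_colorSign_second (a M : ℕ) (ha : 1 ≤ a) (χ : ℕ → Bool) :
    ∑ t ∈ schurTriples a (a * M), colorSign χ t.1 * colorSign χ t.2.1
      + ∑ t ∈ schurTriples a (a * M), colorSign χ t.2.1 * colorSign χ t.2.2 =
    ∑ y ∈ Finset.Ioc 0 M, colorSign χ y *
      (∑ x ∈ Finset.Ioc 0 (a * M - a * y), colorSign χ x
        + (∑ x ∈ Finset.Ioc 0 (a * M), colorSign χ x
        - ∑ x ∈ Finset.Ioc 0 (a * y), colorSign χ x)) := by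
  have hM : M ≤ a * M := Nat.le_mul_of_pos_left _ ha
  have hz : ∀ y ∈ Finset.Ioc 0 (a * M), y ∉ Finset.Ioc 0 M → a * M ≤ a * y := by
    intro y hy hy'
    simp only [Finset.mem_Ioc] at hy hy'
    exact Nat.mul_le_mul_left _ (by omega)
  rw [sum_schurTriples_eq_sum_first, sum_schurTriples_eq_sum_last,
    ← Finset.sum_subset (Finset.Ioc_subset_Ioc_right hM),
    ← Finset.sum_subset (Finset.Ioc_subset_Ioc_right hM), ← Finset.sum_add_distrib]
  · refine Finset.sum_congr rfl fun y hy => ?_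
    have hy' : a * y ≤ a * M := Nat.mul_le_mul_left _ (Finset.mem_Ioc.1 hy).2
    rw [← Finset.sum_Ioc_consecutive _ (Nat.zero_le _) hy', add_sub_cancel_left, mul_add,
      Finset.mul_sum, Finset.mul_sum]
    simp only [mul_comm (colorSign χ y)]
  · intro y hy hy'
    rw [Finset.Ioc_eq_empty (by have := hz y hy hy'; omega), Finset.sum_empty]
  · intro y hy hy'
    rw [Finset.Ioc_eq_empty (by have := hz y hy hy'; omega), Finset.sum_empty]

/-! ### Bounding the correlation with an antisymmetric weight -/

/-- Antisymmetry makes the sums of |K + μ| and |K - μ| equal, hence both equal to their average, and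
(|K + μ| + |K - μ|)/2 = max |K| |μ|. The shift thus exploits a nonzero sum of s at a cost only where
|K| < |μ|. -/
theorem sum_mul_le_of_antisymm (M : ℕ) (s K : ℕ → ℝ) (hs : ∀ y, |s y| ≤ 1)
    (hK : ∀ y ≤ M, K (M - y) = -K y) (μ : ℝ) :
    ∑ y ∈ Finset.Ioc 0 M, s y * K y ≤
      -(μ * ∑ y ∈ Finset.Ioc 0 M, s y) + ∑ y ∈ Finset.range (M + 1), max |K y| |μ| := by
  have h1 : ∑ y ∈ Finset.Ioc 0 M, s y * (K y + μ) ≤ ∑ y ∈ Finset.range (M + 1), |K y + μ| := by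
    calc _ ≤ ∑ y ∈ Finset.Ioc 0 M, |K y + μ| := by
          refine Finset.sum_le_sum fun y _ => (le_abs_self _).trans ?_
          rw [abs_mul]
          exact mul_le_of_le_one_left (abs_nonneg _) (hs y)
      _ ≤ _ := Finset.sum_le_sum_of_subset_of_nonneg
          (fun y hy => by simp only [Finset.mem_Ioc, Finset.mem_range] at hy ⊢; omega)
          (fun _ _ _ => abs_nonneg _)
  have h2 : ∑ y ∈ Finset.range (M + 1), |K y + μ| =
      ∑ y ∈ Finset.range (M + 1), |K y - μ| := by
    rw [← Finset.sum_range_reflect]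
    refine Finset.sum_congr rfl fun y hy => ?_
    rw [show M + 1 - 1 - y = M - y by omega, hK y (by simp at hy; omega), ← abs_neg]
    congr 1; ring
  have h3 : ∑ y ∈ Finset.range (M + 1), |K y + μ| + ∑ y ∈ Finset.range (M + 1), |K y - μ| =
      2 * ∑ y ∈ Finset.range (M + 1), max |K y| |μ| := by
    rw [← Finset.sum_add_distrib, Finset.mul_sum]
    refine Finset.sum_congr rfl fun y _ => ?_
    rcases abs_cases (K y) with ⟨h, _⟩ | ⟨h, _⟩ <;> rcases abs_cases μ with ⟨h', _⟩ | ⟨h', _⟩ <;>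
    rcases abs_cases (K y + μ) with ⟨h'', _⟩ | ⟨h'', _⟩ <;>
    rcases abs_cases (K y - μ) with ⟨h''', _⟩ | ⟨h''', _⟩ <;>
    rw [h, h', h'', h'''] <;> rcases max_cases (K y) μ with ⟨e, _⟩ | ⟨e, _⟩ <;>
    rcases max_cases (K y) (-μ) with ⟨e', _⟩ | ⟨e', _⟩ <;>
    rcases max_cases (-K y) μ with ⟨e'', _⟩ | ⟨e'', _⟩ <;>
    rcases max_cases (-K y) (-μ) with ⟨e''', _⟩ | ⟨e''', _⟩ <;> linarith
  have h4 : ∑ y ∈ Finset.Ioc 0 M, s y * (K y + μ) =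
      ∑ y ∈ Finset.Ioc 0 M, s y * K y + μ * ∑ y ∈ Finset.Ioc 0 M, s y := by
    rw [Finset.mul_sum, ← Finset.sum_add_distrib]
    exact Finset.sum_congr rfl fun y _ => by ring
  linarith

theorem sum_range_max_abs_le (N : ℕ) (K : ℕ → ℝ)
    (hK : ∀ y ≤ 2 * N, K (2 * N - y) = -K y) (c : ℝ) (hc : 0 ≤ c) :
    ∑ y ∈ Finset.range (2 * N + 1), max |K y| c ≤
      2 * ∑ y ∈ Finset.range (N + 1), max |K y| c := by
  rw [show 2 * N + 1 = (N + 1) + N by ring, Finset.sum_range_add, two_mul]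
  refine add_le_add le_rfl ?_
  rw [← Finset.sum_range_reflect, Finset.sum_range_succ]
  have : ∑ y ∈ Finset.range N, max |K (N + 1 + (N - 1 - y))| c =
      ∑ y ∈ Finset.range N, max |K y| c := by
    refine Finset.sum_congr rfl fun y hy => ?_
    have hy' : y < N := by simpa using hy
    rw [show N + 1 + (N - 1 - y) = 2 * N - y by omega, hK y (by omega), abs_neg]
  rw [this]
  exact le_add_of_nonneg_right (hc.trans (le_max_right _ _))

/-- The lower bound for the number of monochromatic triples that results from a bound
`n - 2ay - L y` for the red-blue imbalance between `ay` and `n - ay`. -/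
theorem le_monoCount_of_loss (a N : ℕ) (ha : 1 ≤ a) (χ : ℕ → Bool) (L : ℕ → ℝ) (n s m c : ℝ)
    (hn : n = ((a * (2 * N) : ℕ) : ℝ))
    (hs : s = n - 2 * redCount χ (a * (2 * N)))
    (hm : m = 2 * a * redCount χ (2 * N) - n)
    (hc : 0 ≤ c) (hcs : c ≤ n)
    (hL : ∀ y ≤ N, |2 * ((redCount χ (a * (2 * N) - a * y) : ℝ) - redCount χ (a * y))
      - (n - 2 * a * y)| ≤ n - 2 * a * y - L y)
    (hLc : ∀ y ≤ N, c ≤ max (n - 2 * a * y) c - L y) :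
    (s ^ 2 - 2 * s * m + 2 * c * |m| - c ^ 2) / 2 + 2 * a * ∑ y ∈ Finset.range (N + 1), L y
      - 6 * a * n ≤ 4 * a * (monoCount a (a * (2 * N)) χ : ℝ) := by
  have ha' : (1 : ℝ) ≤ a := by exact_mod_cast ha
  have hn0 : 0 ≤ n := by rw [hn]; positivity
  set K : ℕ → ℝ := fun y => ∑ x ∈ Finset.Ioc 0 (a * y), colorSign χ x
    - ∑ x ∈ Finset.Ioc 0 (a * (2 * N) - a * y), colorSign χ x with hKdef
  have hK : ∀ y ≤ 2 * N, K (2 * N - y) = -K y := by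
    intro y hy
    have h1 : a * y ≤ a * (2 * N) := Nat.mul_le_mul_left _ hy
    have h2 : a * (2 * N - y) = a * (2 * N) - a * y := Nat.mul_sub _ _ _
    have h3 : a * (2 * N) - (a * (2 * N) - a * y) = a * y := by omega
    simp only [hKdef, h2, h3]
    ring
  have hKabs : ∀ y ≤ N, |K y| = |2 * ((redCount χ (a * (2 * N) - a * y) : ℝ)
      - redCount χ (a * y)) - (n - 2 * a * y)| := by
    intro y hy
    have h1 : a * y ≤ a * (2 * N) := Nat.mul_le_mul_left _ (by omega)
    rw [← abs_neg (K y)]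
    congr 1
    simp only [hKdef, sum_colorSign]
    rw [Nat.cast_sub h1, ← hn]; push_cast; ring
  have hbound : ∀ y ∈ Finset.range (N + 1), max |K y| c ≤
      c + max ((n - c) - (2 * a) * (y : ℝ)) 0 - L y := by
    intro y hy
    have hy' : y ≤ N := by simp at hy; omega
    have e : c + max ((n - c) - (2 * a) * (y : ℝ)) 0 = max (n - 2 * a * y) c := by
      rw [add_comm, ← max_add_add_right]; congr 1 <;> ring
    rw [e]
    refine max_le ?_ (hLc y hy')
    rw [hKabs y hy']
    exact (hL y hy').trans (by linarith [le_max_left (n - 2 * a * (y : ℝ)) c])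
  have hsum : ∑ y ∈ Finset.range (N + 1), max |K y| c ≤
      (N + 1) * c + ((n - c) ^ 2 / (4 * a) + (n - c)) - ∑ y ∈ Finset.range (N + 1), L y := by
    refine (Finset.sum_le_sum hbound).trans ?_
    rw [Finset.sum_sub_distrib, Finset.sum_add_distrib]
    have h := sum_range_ramp_le (2 * a : ℝ) (by positivity) (N + 1) (n - c) (by linarith)
    rw [show 2 * (2 * (a : ℝ)) = 4 * a by ring] at h
    simp only [Finset.sum_const, Finset.card_range, nsmul_eq_mul]
    push_cast
    linarith
  -- The shift takes the sign of m, so that it gains c|m|.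
  obtain ⟨μ, hμ, hμm⟩ : ∃ μ : ℝ, |μ| = c ∧ μ * m = c * |m| := by
    rcases le_total 0 m with h | h
    · exact ⟨c, abs_of_nonneg hc, by rw [abs_of_nonneg h]⟩
    · exact ⟨-c, by rw [abs_neg, abs_of_nonneg hc], by rw [abs_of_nonpos h]; ring⟩
  have h1 := sum_mul_le_of_antisymm (2 * N) (colorSign χ) K (fun y => (abs_colorSign χ y).le) hK μ
  have h2 := sum_range_max_abs_le N K hK c hc
  rw [hμ] at h1
  have h3 := four_mul_monoCount a (a * (2 * N)) χ
  have h4 := le_sum_colorSign_first_last a (a * (2 * N)) ha χ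
  have h5 := sum_colorSign_second a (2 * N) ha χ
  have h6 := le_card_schurTriples (a * (2 * N)) ha
  have hP : ∑ y ∈ Finset.Ioc 0 (2 * N), colorSign χ y = m / a := by
    rw [sum_colorSign, hm, hn]; field_simp; push_cast; ring
  have hS : ∑ y ∈ Finset.Ioc 0 (a * (2 * N)), colorSign χ y = -s := by
    rw [sum_colorSign, hs, hn]; ring
  have h7 : ∑ y ∈ Finset.Ioc 0 (2 * N), colorSign χ y *
      (∑ x ∈ Finset.Ioc 0 (a * (2 * N) - a * y), colorSign χ x
        + (∑ x ∈ Finset.Ioc 0 (a * (2 * N)), colorSign χ x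
        - ∑ x ∈ Finset.Ioc 0 (a * y), colorSign χ x)) =
      -s * (m / a) - ∑ y ∈ Finset.Ioc 0 (2 * N), colorSign χ y * K y := by
    rw [← hP, Finset.mul_sum, ← Finset.sum_sub_distrib, hS]
    exact Finset.sum_congr rfl fun y _ => by simp only [hKdef]; ring
  rw [h7] at h5
  rw [hP] at h1
  rw [← hn] at h4 h6
  rw [show 2 * (redCount χ (a * (2 * N)) : ℝ) - n = -s by rw [hs]; ring] at h4
  have hNn : (N : ℝ) = n / (2 * a) := by rw [hn]; push_cast; field_simp
  have hmain : n ^ 2 / (2 * a) - n + (-s * (m / a) + μ * (m / a) - 2 * ((N + 1) * c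
      + ((n - c) ^ 2 / (4 * a) + (n - c)) - ∑ y ∈ Finset.range (N + 1), L y))
      + ((-s) ^ 2 / (2 * a) - n / 2) ≤ 4 * (monoCount a (a * (2 * N)) χ : ℝ) := by
    linarith
  have hmul := mul_le_mul_of_nonneg_left hmain (show (0 : ℝ) ≤ a by linarith)
  have hexp : a * (n ^ 2 / (2 * a) - n + (-s * (m / a) + μ * (m / a) - 2 * ((N + 1) * c
      + ((n - c) ^ 2 / (4 * a) + (n - c)) - ∑ y ∈ Finset.range (N + 1), L y))
      + ((-s) ^ 2 / (2 * a) - n / 2)) =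
      (s ^ 2 - 2 * s * m + 2 * (μ * m) - c ^ 2) / 2 + 2 * a * ∑ y ∈ Finset.range (N + 1), L y
      - a * (7 / 2 * n) := by
    rw [hNn]; field_simp; ring
  rw [hexp, hμm] at hmul
  nlinarith [mul_nonneg (show (0 : ℝ) ≤ a by linarith) hn0]

/-! ### Bounds for the imbalance of a coloring between `u` and `n - u` -/

/-- If at most half of `[1, n]` is red, the imbalance between `u` and `n - u` falls short of
`n - 2u` on account of the red elements of `[1, p]` and of `(p, n]`. -/
theorem abs_imbalance_le (χ : ℕ → Bool) (n p u : ℕ) (α γ δ : ℝ)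
    (hp : 2 * p ≤ n) (hu : 2 * u ≤ n) (hα : α = redCount χ p) (hγ : γ = redCount χ n - α)
    (hhalf : 2 * (α + γ) ≤ n) (hδ : δ = min γ p)
    (h : γ ≤ α ∨ (3 * (α + γ) ≤ n ∧ 3 * p ≤ n)) :
    |2 * ((redCount χ (n - u) : ℝ) - redCount χ u) - (n - 2 * u)| ≤
      n - 2 * u - 2 * (max (δ - u) 0 + max (α - u) 0) := by
  have mono : ∀ {s t : ℕ}, s ≤ t → (redCount χ s : ℝ) ≤ redCount χ t := fun h => by
    exact_mod_cast redCount_mono χ h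
  have lip : ∀ {s t : ℕ}, s ≤ t → (redCount χ t : ℝ) ≤ redCount χ s + (t - s) := fun h => by
    have := redCount_le_add χ h
    rw [← Nat.cast_sub h]
    exact_mod_cast this
  have hun : u ≤ n - u := by omega
  have m1 := mono hun
  have m2 := mono (Nat.sub_le n u)
  have l1 := lip hun
  have l2 := lip (Nat.sub_le n u)
  have l3 := lip (Nat.zero_le u)
  have l4 := lip (Nat.zero_le p)
  have m3 : (0 : ℝ) ≤ redCount χ u := by positivity
  rw [Nat.cast_sub (by omega : u ≤ n)] at l1 l2
  simp only [redCount_zero, Nat.cast_zero] at l3 l4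
  have hpR : 2 * (p : ℝ) ≤ n := by exact_mod_cast hp
  have hδγ : δ ≤ γ := hδ ▸ min_le_left _ _
  have hδp : δ ≤ p := hδ ▸ min_le_right _ _
  have huR : 2 * (u : ℝ) ≤ n := by exact_mod_cast hu
  have hγ0 := mono (show p ≤ n by omega)
  rw [abs_le]
  -- The claim is that (u, n - u] contains at least max(δ - u, 0) + max(α - u, 0) elements of each
  -- color. The hypothesis `h` matters only when α ≤ u ≤ δ, for the blue count; capping δ at p
  -- ensures u ≤ p there.
  rcases le_total δ u with h1 | h1 <;> rcases le_total α u with h2 | h2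
  · rw [max_eq_right (by linarith), max_eq_right (by linarith)]
    constructor <;> linarith
  · have hup : u ≤ p := by
      have : (u : ℝ) ≤ p := by linarith
      exact_mod_cast this
    have m4 := mono (show p ≤ n - u by omega)
    have l5 := lip hup
    rw [max_eq_right (by linarith), max_eq_left (by linarith)]
    constructor <;> linarith
  · have hup : u ≤ p := by
      have : (u : ℝ) ≤ p := by linarith
      exact_mod_cast this
    have m4 := mono hup
    rw [max_eq_left (by linarith), max_eq_right (by linarith)]
    rcases h with h | ⟨h, h'⟩
    · constructor <;> linarith
    · have : 3 * (p : ℝ) ≤ n := by exact_mod_cast h'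
      constructor <;> linarith
  · rw [max_eq_left (by linarith), max_eq_left (by linarith)]
    constructor <;> linarith

/-- Removing u elements at each end leaves at least (n - s)/2 - 2u red ones, and blue is no rarer
overall. This needs no information on where the red elements lie. -/
theorem abs_imbalance_le_tent (χ : ℕ → Bool) (n u : ℕ) (s : ℝ) (hu : 2 * u ≤ n)
    (hs : s = n - 2 * redCount χ n) (hs0 : 0 ≤ s) :
    |2 * ((redCount χ (n - u) : ℝ) - redCount χ u) - (n - 2 * u)| ≤
      n - 2 * u - max (n - s - 4 * u) 0 := by
  have mono : ∀ {s t : ℕ}, s ≤ t → (redCount χ s : ℝ) ≤ redCount χ t := fun h => by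
    exact_mod_cast redCount_mono χ h
  have lip : ∀ {s t : ℕ}, s ≤ t → (redCount χ t : ℝ) ≤ redCount χ s + (t - s) := fun h => by
    have := redCount_le_add χ h
    rw [← Nat.cast_sub h]
    exact_mod_cast this
  have hun : u ≤ n - u := by omega
  have m1 := mono hun
  have m2 := mono (Nat.sub_le n u)
  have l1 := lip hun
  have l2 := lip (Nat.sub_le n u)
  have l3 := lip (Nat.zero_le u)
  have m3 : (0 : ℝ) ≤ redCount χ u := by positivity
  rw [Nat.cast_sub (by omega : u ≤ n)] at l1 l2
  simp only [redCount_zero, Nat.cast_zero] at l3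
  rw [abs_le]
  rcases max_cases (n - s - 4 * (u : ℝ)) 0 with ⟨e, he⟩ | ⟨e, he⟩ <;> rw [e] <;>
    constructor <;> linarith

/-! ### The lower bound -/

theorem le_monoCount_of_red_initial (a N : ℕ) (ha : 2 ≤ a) (χ : ℕ → Bool) (n s m α γ δ c : ℝ)
    (hn : n = ((a * (2 * N) : ℕ) : ℝ)) (hα : α = redCount χ (2 * N))
    (hγ : γ = redCount χ (a * (2 * N)) - α) (hδ : δ = min γ (2 * N))
    (hs : s = n - 2 * (α + γ)) (hm : m = 2 * a * α - n) (hs0 : 0 ≤ s)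
    (hc : 0 ≤ c) (hcs : c ≤ s)
    (h : γ ≤ α ∨ (3 * (α + γ) ≤ n ∧ 3 ≤ a)) :
    (s ^ 2 - 2 * s * m + 2 * c * |m| - c ^ 2) / 2 + 2 * α ^ 2 + 2 * δ ^ 2 - 6 * a * n ≤
      4 * a * (monoCount a (a * (2 * N)) χ : ℝ) := by
  have ha' : (2 : ℝ) ≤ a := by exact_mod_cast ha
  have hn' : n = a * (2 * N) := by rw [hn]; push_cast; ring
  have hα0 : 0 ≤ α := by rw [hα]; positivity
  have hγ0 : 0 ≤ γ := by
    have : (redCount χ (2 * N) : ℝ) ≤ redCount χ (a * (2 * N)) := by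
      exact_mod_cast redCount_mono χ (Nat.le_mul_of_pos_left _ (by omega))
    linarith
  have hδγ : δ ≤ γ := hδ ▸ min_le_left _ _
  have hδN : δ ≤ 2 * N := hδ ▸ min_le_right _ _
  have hδ0 : 0 ≤ δ := by rw [hδ]; exact le_min hγ0 (by positivity)
  have hN0 : (0 : ℝ) ≤ N := by positivity
  have hαN : α ≤ 2 * N := by
    have := redCount_le_add χ (Nat.zero_le (2 * N))
    rw [redCount_zero] at this
    rw [hα]
    exact_mod_cast (by omega : redCount χ (2 * N) ≤ 2 * N)
  have key := le_monoCount_of_loss a N (by omega) χ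
    (fun y => 2 * (max (δ - a * (y : ℝ)) 0 + max (α - a * (y : ℝ)) 0)) n s m c hn
    (by rw [hs, hγ]; ring) (by rw [hm, hα]) hc (by linarith) ?_ ?_
  · rw [← Finset.mul_sum, Finset.sum_add_distrib] at key
    have h1 := le_sum_range_ramp (a : ℝ) (by linarith) (N + 1) δ hδ0
      (by push_cast; nlinarith)
    have h2 := le_sum_range_ramp (a : ℝ) (by linarith) (N + 1) α hα0
      (by push_cast; nlinarith)
    rw [div_le_iff₀ (by linarith)] at h1 h2
    nlinarith
  · intro y hy
    have hu : 2 * (a * y) ≤ a * (2 * N) := by nlinarith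
    have := abs_imbalance_le χ (a * (2 * N)) (2 * N) (a * y) α γ δ
      (Nat.mul_le_mul_right _ ha) hu hα hγ (by rw [← hn]; linarith)
      (by rw [hδ]; push_cast; rfl)
      (h.imp_right fun h => ⟨by rw [← hn]; exact h.1, Nat.mul_le_mul_right _ h.2⟩)
    rw [← hn] at this
    push_cast at this
    simpa only [← mul_assoc] using this
  · intro y _
    have hy0 : 0 ≤ (a : ℝ) * y := by positivity
    rw [le_sub_iff_add_le, le_max_iff, mul_assoc]
    rcases max_cases (δ - a * (y : ℝ)) 0 with ⟨e, he⟩ | ⟨e, he⟩ <;>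
    rcases max_cases (α - a * (y : ℝ)) 0 with ⟨e', he'⟩ | ⟨e', he'⟩ <;> rw [e, e']
    · left; linarith
    · left; linarith
    · left; linarith
    · right; linarith

theorem le_monoCount_tent (a N : ℕ) (ha : 1 ≤ a) (χ : ℕ → Bool) (n s m c : ℝ)
    (hn : n = ((a * (2 * N) : ℕ) : ℝ)) (hs : s = n - 2 * redCount χ (a * (2 * N)))
    (hm : m = 2 * a * redCount χ (2 * N) - n) (hs0 : 0 ≤ s) (hc : 0 ≤ c) (hcs : c ≤ s) :
    (s ^ 2 - 2 * s * m + 2 * c * |m| - c ^ 2) / 2 + (n - s) ^ 2 / 4 - 6 * a * n ≤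
      4 * a * (monoCount a (a * (2 * N)) χ : ℝ) := by
  have ha' : (1 : ℝ) ≤ a := by exact_mod_cast ha
  have hn' : n = a * (2 * N) := by rw [hn]; push_cast; ring
  have hsn : s ≤ n := by
    rw [hs]
    have : (0 : ℝ) ≤ redCount χ (a * (2 * N)) := by positivity
    linarith
  have key := le_monoCount_of_loss a N ha χ
    (fun y => max (n - s - 4 * a * (y : ℝ)) 0) n s m c hn hs hm hc (by linarith) ?_ ?_
  · have h1 := le_sum_range_ramp (4 * a : ℝ) (by linarith) (N + 1) (n - s) (by linarith)
      (by push_cast; nlinarith [(by positivity : (0 : ℝ) ≤ a * N)])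
    rw [div_le_iff₀ (by linarith)] at h1
    nlinarith
  · intro y hy
    have hu : 2 * (a * y) ≤ a * (2 * N) := by nlinarith
    have := abs_imbalance_le_tent χ (a * (2 * N)) (a * y) s hu (by rw [← hn]; exact hs) hs0
    rw [← hn] at this
    push_cast at this
    simpa only [← mul_assoc] using this
  · intro y _
    have hy0 : 0 ≤ (a : ℝ) * y := by positivity
    rw [le_sub_iff_add_le, le_max_iff]
    rcases max_cases (n - s - 4 * a * (y : ℝ)) 0 with ⟨e, he⟩ | ⟨e, he⟩ <;> rw [e]
    · left; linarith
    · right; linarith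

theorem le_monoCount_of_half (a N : ℕ) (ha : 2 ≤ a) (χ : ℕ → Bool) (n : ℝ)
    (hn : n = ((a * (2 * N) : ℕ) : ℝ)) (hhalf : 2 * (redCount χ (a * (2 * N)) : ℝ) ≤ n) :
    2 * n ^ 2 / ((a : ℝ) ^ 2 + 2 * a + 3) - 6 * a * n ≤
      4 * a * (monoCount a (a * (2 * N)) χ : ℝ) := by
  obtain ⟨α, hα⟩ : ∃ α : ℝ, α = redCount χ (2 * N) := ⟨_, rfl⟩
  obtain ⟨γ, hγ⟩ : ∃ γ : ℝ, γ = redCount χ (a * (2 * N)) - α := ⟨_, rfl⟩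
  obtain ⟨s, hs⟩ : ∃ s : ℝ, s = n - 2 * (α + γ) := ⟨_, rfl⟩
  obtain ⟨m, hm⟩ : ∃ m : ℝ, m = 2 * a * α - n := ⟨_, rfl⟩
  obtain ⟨D, hD⟩ : ∃ D : ℝ, D = (a : ℝ) ^ 2 + 2 * a + 3 := ⟨_, rfl⟩
  have ha' : (2 : ℝ) ≤ a := by exact_mod_cast ha
  have hn' : n = a * (2 * N) := by rw [hn]; push_cast; ring
  have hn0 : 0 ≤ n := by rw [hn]; positivity
  have hD0 : 0 < D := by rw [hD]; positivity
  have hs0 : 0 ≤ s := by rw [hs, hγ]; linarith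
  have hα0 : 0 ≤ α := by rw [hα]; positivity
  have hγ0 : 0 ≤ γ := by
    have : (redCount χ (2 * N) : ℝ) ≤ redCount χ (a * (2 * N)) := by
      exact_mod_cast redCount_mono χ (Nat.le_mul_of_pos_left _ (by omega))
    linarith
  rw [← hD]
  suffices h : ∃ E : ℝ, 2 * n ^ 2 ≤ E * D ∧
      E - 6 * a * n ≤ 4 * a * (monoCount a (a * (2 * N)) χ : ℝ) by
    obtain ⟨E, h1, h2⟩ := h
    have : 2 * n ^ 2 / D ≤ E := by rwa [div_le_iff₀ hD0]
    linarith
  have tent := fun c => le_monoCount_tent a N (by omega) χ n s m c hn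
    (by rw [hs, hγ]; ring) (by rw [hm, hα]) hs0
  have initial := fun δ c => le_monoCount_of_red_initial a N ha χ n s m α γ δ c hn hα hγ
  by_cases h : γ ≤ α ∨ (3 * (α + γ) ≤ n ∧ 3 ≤ a)
  · rcases le_total (2 * (N : ℝ)) γ with hγN | hγN
    -- Here δ = n/a, and 2δ² alone suffices because D ≥ a².
    · refine ⟨_, ?_, initial (2 * N) s (by rw [min_eq_right hγN]) hs hm hs0 hs0 le_rfl h⟩
      have h1 : 0 ≤ (s ^ 2 - 2 * s * m + 2 * s * |m| - s ^ 2) / 2 := by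
        nlinarith [le_abs_self m]
      have h2 : 2 * n ^ 2 ≤ (2 * (2 * (N : ℝ)) ^ 2) * D := by
        rw [hn', hD]
        nlinarith [sq_nonneg (N : ℝ), mul_nonneg (sq_nonneg (N : ℝ)) (by linarith : (0 : ℝ) ≤ a)]
      nlinarith [mul_nonneg h1 hD0.le, mul_nonneg (sq_nonneg α) hD0.le]
    · have init := fun c => initial γ c (by rw [min_eq_left hγN]) hs hm hs0
      rcases le_total s |m| with hsm | hsm
      · refine ⟨_, ?_, init s hs0 le_rfl h⟩
        rcases abs_cases m with ⟨e, he⟩ | ⟨e, he⟩ <;> rw [e] at hsm ⊢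
        · have h1 : n ≤ (a + 1) * α + γ := by rw [hs, hm] at hsm; linarith
          have h2 : n ^ 2 ≤ ((a + 1) * α + γ) ^ 2 := by gcongr
          rw [hD]
          linarith [sq_nonneg ((a + 1) * γ - α), sq_nonneg α, sq_nonneg γ,
            show ((s ^ 2 - 2 * s * m + 2 * s * m - s ^ 2) / 2 + 2 * α ^ 2 + 2 * γ ^ 2)
              * ((a : ℝ) ^ 2 + 2 * a + 3) = 2 * ((a + 1) * α + γ) ^ 2
              + 2 * ((a + 1) * γ - α) ^ 2 + 2 * α ^ 2 + 2 * γ ^ 2 by ring]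
        · have h1 : 2 * s ^ 2 + 2 * α ^ 2 + 2 * γ ^ 2 ≤
              (s ^ 2 - 2 * s * m + 2 * s * -m - s ^ 2) / 2 + 2 * α ^ 2 + 2 * γ ^ 2 := by
            nlinarith
          have h2 : 2 * n ^ 2 ≤ (2 * s ^ 2 + 2 * α ^ 2 + 2 * γ ^ 2) * 9 := by
            have : n = s + 2 * α + 2 * γ := by rw [hs]; ring
            rw [this]
            linarith [sq_nonneg (α - γ), sq_nonneg (2 * s - α), sq_nonneg (2 * s - γ),
              show (2 * s ^ 2 + 2 * α ^ 2 + 2 * γ ^ 2) * 9 - 2 * (s + 2 * α + 2 * γ) ^ 2 =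
                2 * (2 * s - α) ^ 2 + 2 * (2 * s - γ) ^ 2 + 8 * (α - γ) ^ 2 by ring]
          have h3 : (9 : ℝ) ≤ D := by rw [hD]; nlinarith
          nlinarith [mul_le_mul_of_nonneg_left h3
            (by positivity : 0 ≤ 2 * s ^ 2 + 2 * α ^ 2 + 2 * γ ^ 2),
            mul_le_mul_of_nonneg_right h1 hD0.le]
      -- The decisive case: c = |m| maximises 2c|m| - c², leaving (s - m)²/2 = 2q².
      · refine ⟨_, ?_, init |m| (abs_nonneg m) hsm h⟩
        have h1 : (s ^ 2 - 2 * s * m + 2 * |m| * |m| - |m| ^ 2) / 2 =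
            2 * (n - γ - (a + 1) * α) ^ 2 := by
          have : s - m = 2 * (n - γ - (a + 1) * α) := by rw [hs, hm]; ring
          linear_combination (1 / 2) * sq_abs m + (s - m + 2 * (n - γ - (a + 1) * α)) / 2 * this
        rw [h1, hD]
        obtain ⟨q, hq⟩ : ∃ q : ℝ, q = n - γ - (a + 1) * α := ⟨_, rfl⟩
        rw [← hq, show n = q + γ + (a + 1) * α by rw [hq]; ring]
        linarith [sq_nonneg (q - γ), sq_nonneg ((a + 1) * γ - α), sq_nonneg ((a + 1) * q - α),
          show (2 * q ^ 2 + 2 * α ^ 2 + 2 * γ ^ 2) * ((a : ℝ) ^ 2 + 2 * a + 3)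
            - 2 * (q + γ + (a + 1) * α) ^ 2 = 2 * (q - γ) ^ 2 + 2 * ((a + 1) * γ - α) ^ 2
            + 2 * ((a + 1) * q - α) ^ 2 by ring]
  · push Not at h
    rcases (show a = 2 ∨ 3 ≤ a by omega) with ha2 | ha3
    -- For a = 2, γ > α means m < -s, so no shift is needed: 3s²/2 + (n - s)²/4 is least at s = n/7,
    -- with value 3n²/14 > 2n²/11.
    · refine ⟨_, ?_, tent 0 le_rfl hs0⟩
      have h1 : a * (1 : ℝ) = 2 := by rw [ha2]; norm_num
      have haR : (a : ℝ) = 2 := by linarith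
      have hms : m ≤ -s := by rw [hm, hs, haR]; linarith [h.1]
      have hD11 : D = 11 := by rw [hD, haR]; norm_num
      rw [hD11]
      have h2 : s ^ 2 ≤ -(s * m) := by nlinarith
      nlinarith [sq_nonneg (7 * s - n)]
    -- For a ≥ 3 more than a third is red, so the loss term (α + γ)² ≥ n²/9 suffices, as D ≥ 18.
    · refine ⟨_, ?_, tent s hs0 le_rfl⟩
      have h1 : 0 ≤ (s ^ 2 - 2 * s * m + 2 * s * |m| - s ^ 2) / 2 := by
        nlinarith [le_abs_self m]
      have h2 : n / 3 ≤ α + γ := by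
        by_contra hlt
        exact absurd (h.2 (by linarith)) (by omega)
      have h3 : (n - s) ^ 2 / 4 = (α + γ) ^ 2 := by rw [hs]; ring
      have h4 : (n / 3) ^ 2 ≤ (α + γ) ^ 2 := by gcongr
      have h5 : (18 : ℝ) ≤ D := by
        have : (3 : ℝ) ≤ a := by exact_mod_cast ha3
        rw [hD]; nlinarith
      rw [h3]
      nlinarith [mul_nonneg h1 hD0.le, mul_le_mul h4 h5 (by norm_num) (sq_nonneg (α + γ))]

/-- Truncating n to a multiple of 2a changes n² by at most 4an, and swapping the colors makes red
the minority. -/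
theorem le_monoCount (a : ℕ) (ha : 2 ≤ a) (n : ℕ) (χ : ℕ → Bool) :
    (n : ℝ) ^ 2 / (2 * (a : ℝ) * ((a : ℝ) ^ 2 + 2 * (a : ℝ) + 3)) - 4 * a * n ≤
      (monoCount a n χ : ℝ) := by
  set N := n / (2 * a) with hN
  have ha' : (2 : ℝ) ≤ a := by exact_mod_cast ha
  have hdm : 2 * a * N + n % (2 * a) = n := Nat.div_add_mod n (2 * a)
  have hlt : n % (2 * a) < 2 * a := Nat.mod_lt _ (by omega)
  have hassoc : a * (2 * N) = 2 * a * N := by ring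
  have hle : a * (2 * N) ≤ n := by omega
  have hge : n ≤ a * (2 * N) + 2 * a := by omega
  obtain ⟨k, hk⟩ : ∃ k : ℝ, k = ((a * (2 * N) : ℕ) : ℝ) := ⟨_, rfl⟩
  have hk0 : 0 ≤ k := by rw [hk]; positivity
  have hkn : k ≤ n := by rw [hk]; exact_mod_cast hle
  have hnk : (n : ℝ) ≤ k + 2 * a := by rw [hk]; exact_mod_cast hge
  have main : 2 * k ^ 2 / ((a : ℝ) ^ 2 + 2 * a + 3) - 6 * a * k ≤
      4 * a * (monoCount a (a * (2 * N)) χ : ℝ) := by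
    rcases le_total (2 * (redCount χ (a * (2 * N)) : ℝ)) k with h | h
    · exact le_monoCount_of_half a N ha χ k hk h
    · have hnot : (redCount (fun x => !χ x) (a * (2 * N)) : ℝ) + redCount χ (a * (2 * N)) = k := by
        rw [hk]; exact_mod_cast redCount_not χ (a * (2 * N))
      rw [← monoCount_not]
      exact le_monoCount_of_half a N ha _ k hk (by linarith)
  have hmono : (monoCount a (a * (2 * N)) χ : ℝ) ≤ monoCount a n χ := by
    exact_mod_cast monoCount_mono a χ hle
  set D : ℝ := (a : ℝ) ^ 2 + 2 * a + 3 with hD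
  have hD0 : 0 < D := by positivity
  have hDa : 4 * a ≤ D := by rw [hD]; nlinarith [sq_nonneg ((a : ℝ) - 1)]
  have hsq : (n : ℝ) ^ 2 ≤ k ^ 2 + 4 * a * n := by nlinarith
  have h1 : 2 * (n : ℝ) ^ 2 / D ≤ 2 * k ^ 2 / D + 2 * n := by
    rw [div_add' _ _ _ hD0.ne', div_le_div_iff_of_pos_right hD0]
    nlinarith [mul_le_mul_of_nonneg_right hDa (Nat.cast_nonneg n : (0 : ℝ) ≤ n)]
  have h2 : 4 * a * ((n : ℝ) ^ 2 / (2 * a * D)) = 2 * (n : ℝ) ^ 2 / D := by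
    field_simp; ring
  have hn0 : (0 : ℝ) ≤ n := by positivity
  refine le_of_mul_le_mul_left ?_ (show (0 : ℝ) < 4 * a by linarith)
  rw [mul_sub, h2]
  nlinarith [mul_nonneg hn0 (by linarith : (0 : ℝ) ≤ a - 2),
    mul_nonneg (mul_nonneg hn0 (by linarith : (0 : ℝ) ≤ a - 2)) (by linarith : (0 : ℝ) ≤ a)]

/-- For fixed `a ≥ 2`: the total number of triples is `n² / (2a) + O(n)`; every 2-coloring of
`[1, n]` has at least `n² / (2a(a² + 2a + 3)) + O(n)` monochromatic triples; and some 2-coloring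
of `[1, n]` attains this up to `O(n)`. The constant in `O(n)` depends only on `a`. -/
theorem corollary4 (a : ℕ) (ha : 2 ≤ a) :
    ∃ C : ℝ, ∀ n : ℕ,
      |((schurTriples a n).card : ℝ) - (n : ℝ) ^ 2 / (2 * (a : ℝ))| ≤ C * (n : ℝ) ∧
      (∀ χ : ℕ → Bool,
        (n : ℝ) ^ 2 / (2 * (a : ℝ) * ((a : ℝ) ^ 2 + 2 * (a : ℝ) + 3)) - C * (n : ℝ)
          ≤ (monoCount a n χ : ℝ)) ∧
      (∃ χ : ℕ → Bool,
        (monoCount a n χ : ℝ)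
          ≤ (n : ℝ) ^ 2 / (2 * (a : ℝ) * ((a : ℝ) ^ 2 + 2 * (a : ℝ) + 3)) + C * (n : ℝ)) := by
  have ha' : (2 : ℝ) ≤ a := by exact_mod_cast ha
  -- Dominates the three error constants 1, 4a and a² + 2a + 3.
  refine ⟨(a : ℝ) ^ 2 + 4 * a + 3, fun n => ?_⟩
  have hn0 : (0 : ℝ) ≤ n := by positivity
  have han : 0 ≤ (a : ℝ) * n := by positivity
  have hsn : 0 ≤ (a : ℝ) ^ 2 * n := by positivity
  refine ⟨?_, fun χ => ?_, ?_⟩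
  · have h1 := card_schurTriples_le n (show 1 ≤ a by omega)
    have h2 := le_card_schurTriples n (show 1 ≤ a by omega)
    rw [abs_le]
    constructor <;> linarith
  · have := le_monoCount a ha n χ
    linarith
  · obtain ⟨χ, hχ⟩ := exists_monoCount_le a ha n
    exact ⟨χ, by linarith⟩
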